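/- **Environment.** Let $G=(V,E)$ be a finite simple undirected graph composed of a main area $V_M\subseteq V$ and finitely many trees $V_T^1,\dots,V_T^B$: the subgraph induced on $V_M$ is bi-connected (connected, and still connected after removal of any one node), the subgraph induced on each $V_T^k$ is a tree, $V_M\cap V_T^k=\{c_k\}$ ($c_k$ is the connecting node), the sets ${V'}_T^k=V_T^k\setminus V_M$ are pairwise disjoint and together with $V_M$ cover $V$, and every edge lies inside $V_M$ or inside one $V_T^k$. "In the $k$-th tree" means in ${V'}_T^k$. Let $A$ be a finite non-empty set of agents at distinct initial nodes, and $\mathcal T$ a finite family of tasks $\tau=(s^\tau,g^\tau)$ (pickup and delivery nodes). Write $f_i(v)$ for the distance in $G$ from $v$ to the current destination $d_i$ of agent $a_i$, and $v_i(t)$ for its node at timestep $t$. **Assumptions.** (A1) $|A|<|V_M|$. (A2) $s^\tau$ and $g^\tau$ are never in the same tree. (A3) An agent in a tree is not given a task whose pickup node is in that tree. (A4) An agent does not enter trees that do not contain its destination. (A5) In a tree an agent moves only on the shortest path to its destination (A4 and A5 are built into the sets $C_i$ below). **Task execution.** At each timestep $t$, first each agent at its destination loads (at $s^\tau$; its destination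 becomes $g^\tau$) or unloads (at $g^\tau$; $\tau$ is completed and the agent is free); then free agents may be given tasks not given before, each task being given at most once (the destination becomes $s^\tau$, and an agent already at $s^\tau$ loads at once, and unloads at once if moreover $g^\tau=s^\tau$); then all agents carry out one round of PIBTTP and move. Which tasks are given to which agents and when is arbitrary, except that, whenever some task has not been given and all agents are free and in $V_M$, some task is given at a later timestep. A free agent uses as $d_i$ an arbitrary node of $V_M$, which may change at every timestep. The numbers $\varepsilon_i\in(0,1)$ are pairwise distinct at every timestep, and $\varepsilon_i$ may change only when $a_i$ arrives at the pickup or delivery node it heads for. **PIBTTP at timestep $t$.** The priority of $a_i$ is $1+\varepsilon_i$ if $a_i$ is in a tree that does not contain $d_i$; otherwise it is $-f_i(v_i(t))+\varepsilon_i$ if $a_i$ has a task, and $-|V|+\varepsilon_i$ if it is free (below all agents with a task). Set $U=A$, $O=\varnothing$; while $U\neq\varnothing$, call $\mathrm{exPIBT}(a_i,\perp)$ for the agent $a_i\in U$ of highest priority. The call $\mathrm{exPIBT}(a_i,a_j)$ removes $a_i$ from $U$ and lets $C_i$ be the set of nodes $v\notin O$ that are equal or adjacent to $v_i(t)$, differ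 from $v_j(t)$ (if $a_j\ne\perp$), and satisfy: if $v_i(t)\in V_M$, then $v\in V_M$ or $v$ is on the shortest path between $c_k$ and $d_i$ inside the tree ${V'}_T^k$ that contains $d_i$; if $v_i(t)\in {V'}_T^k$, then $v\in V_T^k$ is on the shortest path between $c_k$ and $d_i$ (when $d_i\in{V'}_T^k$) or on a shortest path from $v_i(t)$ to $d_i$ (when $d_i\notin {V'}_T^k$). While $C_i\ne\varnothing$: choose $v\in C_i$ minimizing $f_i$ (ties broken arbitrarily) and add $v$ to $O$; if no agent of $U$ is at $v$, set $v_i(t+1)=v$ and return VALID; if $a_k\in U$ is at $v$, call $\mathrm{exPIBT}(a_k,a_i)$, and if it returns VALID set $v_i(t+1)=v$ and return VALID, else replace $C_i$ by $C_i\setminus O$. When $C_i=\varnothing$, set $v_i(t+1)=v_i(t)$ and return INVALID. **Theorem.** In every such execution the motion is free of collisions (each agent stays or moves along an edge, two agents are never on the same node, and two agents never exchange their nodes in one timestep), and there is a timestep $T$ by which all tasks of $\mathcal T$ are completed: every $\tau\in\mathcal T$ has been given to an agent which, heading for $s^\tau$, reached $s^\tau$ and then, heading for $g^\tau$, reached $g^\tau$,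 at a timestep $\le T$. -/

import Mathlib

namespace PIBTTP

/-- The subgraph of `G` induced on `S` is bi-connected: it is connected, and any two of its nodes
stay connected when one other node is removed. -/
def Biconnected {V : Type*} (G : SimpleGraph V) (S : Set V) : Prop :=
  (G.induce S).Connected ∧ ∀ v ∈ S, (G.induce (S \ {v})).Preconnected

/-- An environment: a bi-connected main area and trees, the `k`-th of which shares with the main
area exactly its connecting node `conn k`. -/
structure Environment (V κ : Type*) where
  /-- the whole environment -/
  graph : SimpleGraph V
  /-- the nodes `V_M` of the main area -/
  main : Set V
  /-- the nodes `V_T^k` of the `k`-th tree, connecting node included -/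
  tree : κ → Set V
  /-- the connecting node of the `k`-th tree -/
  conn : κ → V
  main_biconnected : Biconnected graph main
  tree_isTree : ∀ k, (graph.induce (tree k)).IsTree
  main_inter_tree : ∀ k, main ∩ tree k = {conn k}
  cover : ∀ v, v ∈ main ∨ ∃ k, v ∈ tree k
  tree_disjoint : ∀ k l, k ≠ l → Disjoint (tree k \ main) (tree l \ main)
  edge_cover : ∀ u v, graph.Adj u v →
    (u ∈ main ∧ v ∈ main) ∨ ∃ k, u ∈ tree k ∧ v ∈ tree k

/-- The `k`-th tree without its connecting node, `V'_T^k`. An agent is "in the `k`-th tree", and a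
destination is "in the `k`-th tree", when it is in this set. -/
def Environment.branch {V κ : Type*} (E : Environment V κ) (k : κ) : Set V :=
  E.tree k \ E.main

/-- `v` lies on a shortest path from `u` to `w`. -/
def OnShortest {V : Type*} (G : SimpleGraph V) (u w v : V) : Prop :=
  G.Reachable u v ∧ G.Reachable v w ∧ G.dist u v + G.dist v w = G.dist u w

open Classical in
/-- The nodes `v` of the `k`-th tree on which an agent at `x` with destination `d` may be. If `d` is
in that tree, they form the shortest path between the connecting node and `d` (along which the agent
advances and can be pushed back); otherwise they form the part inside the tree of the shortest path
from `x` out of the tree to `d`. -/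
def treeWay {V κ : Type*} (E : Environment V κ) (k : κ) (x d : V) : Set V :=
  {v | v ∈ E.tree k ∧ OnShortest E.graph (if d ∈ E.branch k then E.conn k else x) d v}

/-- The nodes that an agent at `x` with destination `d` may take next, apart from adjacency and
conflicts with other agents. From the main area it may go to nodes of the main area and to nodes of
the tree that contains `d`, there only on the way to `d`. -/
def allowed {V κ : Type*} (E : Environment V κ) (x d : V) : Set V :=
  {v | (x ∈ E.main ∧ (v ∈ E.main ∨ ∃ k, d ∈ E.branch k ∧ v ∈ E.branch k ∧ v ∈ treeWay E k x d)) ∨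
    ∃ k, x ∈ E.branch k ∧ v ∈ treeWay E k x d}

/-- The set `C_i` at the beginning of a call `exPIBT(i, j)`, for the current set `O`. -/
def candidates {V κ A : Type*} (E : Environment V κ) (pos dest : A → V) (O : Set V)
    (i : A) (j : Option A) : Set V :=
  {v | (v = pos i ∨ E.graph.Adj (pos i) v) ∧ v ∉ O ∧ (∀ a, j = some a → v ≠ pos a) ∧
    v ∈ allowed E (pos i) (dest i)}

/-- The variables of the planning procedure: `U`, the agents that have not been considered yet, `O`,
the nodes already claimed for the next timestep, and the next nodes. -/
structure Memory (V A : Type*) where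
  U : Set A
  O : Set V
  next : A → V

open Classical in
/-- `Choose E pos dest i C m m' b`: the loop of `exPIBT` for agent `i`, started with the set `C` of
candidates and memory `m`, can end with memory `m'` and answer `b` (`true` for VALID, `false` for
INVALID). Ties in the minimum of the distance to the destination are broken arbitrarily. The call
`exPIBT(k, i)` for the agent `k` that has to make room removes `k` from `U` and runs the loop of `k`
with its own candidates. An inherited priority is never read again, since an agent leaves `U` when
it inherits one, so it needs no variable. -/
inductive Choose {V κ A : Type*} (E : Environment V κ) (pos dest : A → V) :
    A → Set V → Memory V A → Memory V A → Bool → Prop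
  | invalid (i : A) (m : Memory V A) :
      Choose E pos dest i ∅ m { m with next := Function.update m.next i (pos i) } false
  | vacant (i : A) (C : Set V) (m : Memory V A) (v : V) (hv : v ∈ C)
      (hmin : ∀ w ∈ C, E.graph.dist v (dest i) ≤ E.graph.dist w (dest i))
      (hfree : ∀ k ∈ m.U, pos k ≠ v) :
      Choose E pos dest i C m
        { m with O := insert v m.O, next := Function.update m.next i v } true
  | push (i : A) (C : Set V) (m m' : Memory V A) (v : V) (k : A) (hv : v ∈ C)
      (hmin : ∀ w ∈ C, E.graph.dist v (dest i) ≤ E.graph.dist w (dest i))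
      (hk : k ∈ m.U) (hkv : pos k = v)
      (hcall : Choose E pos dest k (candidates E pos dest (insert v m.O) k (some i))
        { m with U := m.U \ {k}, O := insert v m.O } m' true) :
      Choose E pos dest i C m { m' with next := Function.update m'.next i v } true
  | backtrack (i : A) (C : Set V) (m m' m'' : Memory V A) (b : Bool) (v : V) (k : A) (hv : v ∈ C)
      (hmin : ∀ w ∈ C, E.graph.dist v (dest i) ≤ E.graph.dist w (dest i))
      (hk : k ∈ m.U) (hkv : pos k = v)
      (hcall : Choose E pos dest k (candidates E pos dest (insert v m.O) k (some i))
        { m with U := m.U \ {k}, O := insert v m.O } m' false)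
      (hrest : Choose E pos dest i (C \ m'.O) m' m'' b) :
      Choose E pos dest i C m m'' b

/-- The main loop: as long as `U` is not empty, call `exPIBT(i, ⊥)` for the agent `i` of highest
priority in `U`. -/
inductive Drain {V κ A : Type*} (E : Environment V κ) (pos dest : A → V) (pri : A → ℝ) :
    Memory V A → Memory V A → Prop
  | finish (m : Memory V A) (hU : m.U = ∅) : Drain E pos dest pri m m
  | call (m m' m'' : Memory V A) (i : A) (b : Bool) (hi : i ∈ m.U)
      (hmax : ∀ k ∈ m.U, pri k ≤ pri i)
      (hcall : Choose E pos dest i (candidates E pos dest m.O i none)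
        { m with U := m.U \ {i} } m' b)
      (hrest : Drain E pos dest pri m' m'') :
      Drain E pos dest pri m m''

/-- One timestep of PIBTTP can lead from the positions `pos` to the positions `pos'`. -/
def Step {V κ A : Type*} (E : Environment V κ) (pos dest : A → V) (pri : A → ℝ)
    (pos' : A → V) : Prop :=
  ∃ m, Drain E pos dest pri { U := Set.univ, O := ∅, next := pos } m ∧ m.next = pos'

/-- The loop of `exPIBT` always terminates. -/
theorem exists_choose {V κ A : Type*} [Finite V] [Finite A] (E : Environment V κ)
    (pos dest : A → V) (n : ℕ) : ∀ (m : Memory V A) (i : A) (C : Set V), m.U.ncard = n →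
      ∃ m' b, Choose E pos dest i C m m' b ∧ m'.U ⊆ m.U := by
  induction n using Nat.strong_induction_on with
  | _ n ih =>
    intro m i C hn
    rcases C.eq_empty_or_nonempty with rfl | hC
    · exact ⟨_, _, .invalid i m, subset_rfl⟩
    obtain ⟨v, hv, hmin⟩ := Set.exists_min_image C (fun w => E.graph.dist w (dest i)) C.toFinite hC
    by_cases hk : ∃ k ∈ m.U, pos k = v
    · obtain ⟨k, hk, hkv⟩ := hk
      have hlt : (m.U \ {k}).ncard < n := hn ▸ Set.ncard_sdiff_singleton_lt_of_mem hk
      obtain ⟨m₁, b₁, h₁, hU₁⟩ := ih _ hlt { m with U := m.U \ {k}, O := insert v m.O } k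
        (candidates E pos dest (insert v m.O) k (some i)) rfl
      have hsub : m₁.U ⊆ m.U := hU₁.trans Set.sdiff_subset
      cases b₁ with
      | true => exact ⟨_, _, .push i C m m₁ v k hv hmin hk hkv h₁, hsub⟩
      | false =>
        obtain ⟨m₂, b₂, h₂, hU₂⟩ := ih _ ((Set.ncard_le_ncard hU₁).trans_lt hlt) m₁ i (C \ m₁.O) rfl
        exact ⟨_, _, .backtrack i C m m₁ m₂ b₂ v k hv hmin hk hkv h₁ h₂, hU₂.trans hsub⟩
    · push Not at hk
      exact ⟨_, _, .vacant i C m v hv hmin hk, subset_rfl⟩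

/-- From any positions, a timestep of PIBTTP can be carried out. -/
theorem exists_step {V κ A : Type*} [Finite V] [Finite A] (E : Environment V κ)
    (pos dest : A → V) (pri : A → ℝ) : ∃ pos', Step E pos dest pri pos' := by
  have key : ∀ (n : ℕ) (m : Memory V A), m.U.ncard = n → ∃ m', Drain E pos dest pri m m' := by
    intro n
    induction n using Nat.strong_induction_on with
    | _ n ih =>
      intro m hn
      rcases m.U.eq_empty_or_nonempty with hU | hU
      · exact ⟨m, .finish m hU⟩
      obtain ⟨i, hi, hmax⟩ := Set.exists_max_image m.U pri m.U.toFinite hU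
      obtain ⟨m₁, b, h₁, hU₁⟩ := exists_choose E pos dest _ { m with U := m.U \ {i} } i
        (candidates E pos dest m.O i none) rfl
      have hlt : (m.U \ {i}).ncard < n := hn ▸ Set.ncard_sdiff_singleton_lt_of_mem hi
      obtain ⟨m₂, h₂⟩ := ih _ ((Set.ncard_le_ncard hU₁).trans_lt hlt) m₁ rfl
      exact ⟨m₂, .call m m₁ m₂ i b hi hmax h₁ h₂⟩
  obtain ⟨m, hm⟩ := key _ { U := Set.univ, O := ∅, next := pos } rfl
  exact ⟨m.next, m, hm, rfl⟩

/-- What an agent is doing: it has no task, or it heads for the pickup node of a task, or it has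
loaded the material and heads for the delivery node. -/
inductive Job (ι : Type*)
  | free
  | toPickup (τ : ι)
  | toDelivery (τ : ι)

open Classical in
/-- Loading and unloading at the node `v`: an agent that heads for the pickup node `s τ` loads there,
an agent that has loaded unloads at the delivery node `g τ`, which completes `τ`. -/
noncomputable def arrive {V ι : Type*} (s g : ι → V) (v : V) : Job ι → Job ι
  | .free => .free
  | .toPickup τ => if v = s τ then (if v = g τ then .free else .toDelivery τ) else .toPickup τ
  | .toDelivery τ => if v = g τ then .free else .toDelivery τ

/-- An agent at `v` with job `j` that is possibly given a new task. -/
noncomputable def take {V ι : Type*} (s g : ι → V) (v : V) (j : Job ι) : Option ι → Job ι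
  | none => j
  | some τ => arrive s g v (.toPickup τ)

/-- The current destination; `park` is used for an agent without a task. -/
def destination {V ι : Type*} (s g : ι → V) (park : V) : Job ι → V
  | .free => park
  | .toPickup τ => s τ
  | .toDelivery τ => g τ

open Classical in
/-- The priority of an agent at `x` with job `j`, destination `d` and random number `e`: the
temporary priority `1 + e` in a tree that does not contain `d`; the normal priority `-f(x) + e` for
an agent with a task elsewhere. An agent without a task outside the trees comes after all agents
with a task (whose normal priority exceeds `1 - |V|`). -/
noncomputable def priority {V κ ι : Type*} [Fintype V] (E : Environment V κ) (x d : V) (e : ℝ)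
    (j : Job ι) : ℝ :=
  if ∃ k, x ∈ E.branch k ∧ d ∉ E.branch k then 1 + e
  else match j with
    | .free => -(Fintype.card V : ℝ) + e
    | _ => -(E.graph.dist x d : ℝ) + e

/-- An execution of PIBTTP by the agents `A` for the tasks `τ : ι` with pickup node `s τ` and
delivery node `g τ`. At each timestep `t`, agents that are at their destinations load or unload,
then free agents may be given tasks, then all agents plan and move. -/
structure Execution {V κ ι : Type*} [Fintype V] (E : Environment V κ) (s g : ι → V)
    (A : Type*) where
  /-- the position of each agent at each timestep -/
  pos : ℕ → A → V
  /-- the task, if any, that is given to an agent at timestep `t` -/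
  assign : ℕ → A → Option ι
  /-- the job after loading and unloading at timestep `t` -/
  held : ℕ → A → Job ι
  /-- the job with which the agent plans at timestep `t` -/
  job : ℕ → A → Job ι
  /-- where an agent would go at timestep `t` if it has no task -/
  park : ℕ → A → V
  /-- the numbers `ε_i` -/
  eps : ℕ → A → ℝ
  pos_zero_injective : Function.Injective (pos 0)
  held_zero : ∀ a, held 0 a = .free
  held_succ : ∀ t a, held (t + 1) a = arrive s g (pos (t + 1) a) (job t a)
  job_eq : ∀ t a, job t a = take s g (pos t a) (held t a) (assign t a)
  /-- only an agent without a task is given one -/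
  assign_free : ∀ t a, assign t a ≠ none → held t a = .free
  /-- no task is given twice -/
  assign_once : ∀ t t' a a' τ, assign t a = some τ → assign t' a' = some τ → t = t' ∧ a = a'
  park_main : ∀ t a, park t a ∈ E.main
  eps_pos : ∀ t a, 0 < eps t a
  eps_lt_one : ∀ t a, eps t a < 1
  eps_injective : ∀ t, Function.Injective (eps t)
  /-- `ε_i` may change only when the agent arrives at the pickup or delivery node it heads for,
  which includes being given a task with pickup node at its position -/
  eps_change : ∀ t a, eps (t + 1) a ≠ eps t a →
    (∃ τ, job t a = .toPickup τ ∧ pos (t + 1) a = s τ) ∨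
    (∃ τ, job t a = .toDelivery τ ∧ pos (t + 1) a = g τ) ∨
    (∃ τ, assign (t + 1) a = some τ ∧ pos (t + 1) a = s τ)
  step : ∀ t, Step E (pos t) (fun a => destination s g (park t a) (job t a))
    (fun a => priority E (pos t a) (destination s g (park t a) (job t a)) (eps t a) (job t a))
    (pos (t + 1))

/-- Task `τ` has been completed by timestep `T`: some agent was given `τ` at a timestep `t₁`, then
headed for the pickup node until it was there at `t₂`, then headed for the delivery node until it was
there at `t₃ ≤ T`. -/
def Execution.CompletedBy {V κ ι A : Type*} [Fintype V] {E : Environment V κ} {s g : ι → V}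
    (r : Execution E s g A) (τ : ι) (T : ℕ) : Prop :=
  ∃ a t₁ t₂ t₃, t₁ ≤ t₂ ∧ t₂ ≤ t₃ ∧ t₃ ≤ T ∧ r.assign t₁ a = some τ ∧
    (∀ t, t₁ ≤ t → t < t₂ → r.job t a = .toPickup τ) ∧ r.pos t₂ a = s τ ∧
    (∀ t, t₂ ≤ t → t < t₃ → r.job t a = .toDelivery τ) ∧ r.pos t₃ a = g τ

/-- Agents move along edges or stay, are never on the same node, and never pass each other. -/
def CollisionFree {V A : Type*} (G : SimpleGraph V) (pos : ℕ → A → V) : Prop :=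
  (∀ t a, pos (t + 1) a = pos t a ∨ G.Adj (pos t a) (pos (t + 1) a)) ∧
  (∀ t a b, a ≠ b → pos t a ≠ pos t b) ∧
  (∀ t a b, a ≠ b → pos t a ≠ pos (t + 1) b ∨ pos (t + 1) a ≠ pos t b)

end PIBTTP

namespace PIBTTP

/-! ### Distances in an environment -/

section Environment

variable {V κ : Type*} (E : Environment V κ)

/-! Safety. A node claimed during a failed (INVALID) call carries an agent that the call has
considered, and that agent stays there. Hence the node of an agent making a top-level call is never
lost to its own failed pushes. That agent may also stay by the rules if its position is `Regular`,
so every top-level call answers VALID (`Choose.valid_of_self_mem`). A VALID call gives its agents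
distinct, newly claimed nodes, and no pushed agent moves to the node of its pusher
(`Choose.compatible_of_valid`). Regularity persists: allowed moves preserve it, and the assumptions
on tasks and trees cover changes of destination.

Progress. Suppose that the first push of the agent of highest priority, at `x`, fails. The claimed
nodes are then occupied and closed under the allowed moves of their agents, except moves to `x`
(`Choose.closed_of_invalid`). If they met the main area outside `x`, bi-connectivity would spread
them over the whole main area without `x`, which is too much for fewer than |V_M| agents
(`not_mem_main_of_closed`). If the agent is leaving a tree that does not contain its destination,
the claimed set can be followed down to the connecting node, a contradiction. If no agent is in such
a tree, a push into the main area is excluded directly, and a push into a tree succeeds because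
every agent there still has to go deeper. So the first agent gets nearer to its destination.

Termination. After the last assignment the lexicographic quantity `Execution.remaining` decreases
until all agents are free and in the main area. At that time no task can be left ungiven, and an
agent that is free again has completed its tasks. -/

theorem Environment.conn_mem (k : κ) : E.conn k ∈ E.main ∩ E.tree k := by
  rw [E.main_inter_tree k]; exact Set.mem_singleton _

theorem Environment.eq_conn {k : κ} {v : V} (hm : v ∈ E.main) (ht : v ∈ E.tree k) :
    v = E.conn k := by
  have h : v ∈ E.main ∩ E.tree k := ⟨hm, ht⟩
  rwa [E.main_inter_tree k] at h

theorem Environment.mem_main_or_branch (v : V) : v ∈ E.main ∨ ∃ k, v ∈ E.branch k := by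
  by_cases h : v ∈ E.main
  · exact .inl h
  · obtain ⟨k, hk⟩ := (E.cover v).resolve_left h
    exact .inr ⟨k, hk, h⟩

theorem Environment.branch_unique {k l : κ} {v : V} (hk : v ∈ E.branch k) (hl : v ∈ E.tree l) :
    k = l := by
  by_contra hne
  exact Set.disjoint_left.1 (E.tree_disjoint k l hne) hk ⟨hl, hk.2⟩

theorem Environment.mem_tree_of_adj {k : κ} {u v : V} (hu : u ∈ E.branch k)
    (h : E.graph.Adj u v) : v ∈ E.tree k := by
  rcases E.edge_cover u v h with h' | ⟨l, hul, hvl⟩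
  · exact absurd h'.1 hu.2
  · rwa [E.branch_unique hu hul]

theorem Environment.graph_connected : E.graph.Connected := by
  have lift : ∀ {S : Set V}, (E.graph.induce S).Preconnected → ∀ u ∈ S, ∀ v ∈ S,
      E.graph.Reachable u v := fun h u hu v hv =>
    (h ⟨u, hu⟩ ⟨v, hv⟩).map (SimpleGraph.Embedding.induce _).toHom
  have hM := lift E.main_biconnected.1.preconnected
  have hm : ∀ v, ∃ c ∈ E.main, E.graph.Reachable v c := fun v => by
    rcases E.mem_main_or_branch v with h | ⟨k, h⟩
    · exact ⟨v, h, .refl v⟩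
    · exact ⟨E.conn k, (E.conn_mem k).1,
        lift (E.tree_isTree k).connected.preconnected v h.1 _ (E.conn_mem k).2⟩
  obtain ⟨x⟩ := E.main_biconnected.1.nonempty
  have : Nonempty V := ⟨x⟩
  refine ⟨fun u v => ?_⟩
  obtain ⟨a, ha, hua⟩ := hm u
  obtain ⟨b, hb, hvb⟩ := hm v
  exact hua.trans ((hM a ha b hb).trans hvb.symm)

theorem Environment.onShortest_iff {u w v : V} : OnShortest E.graph u w v ↔
    E.graph.dist u v + E.graph.dist v w = E.graph.dist u w :=
  ⟨fun h => h.2.2, fun h => ⟨E.graph_connected.preconnected _ _,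
    E.graph_connected.preconnected _ _, h⟩⟩

theorem Environment.dist_triangle (u v w : V) :
    E.graph.dist u w ≤ E.graph.dist u v + E.graph.dist v w :=
  E.graph_connected.dist_triangle

theorem Environment.exists_adj_dist {x d : V} (h : x ≠ d) :
    ∃ v, E.graph.Adj x v ∧ E.graph.dist v d + 1 = E.graph.dist x d := by
  obtain ⟨p, hp⟩ := E.graph_connected.exists_walk_length_eq_dist x d
  cases p with
  | nil => exact absurd rfl h
  | @cons _ v _ hadj q =>
    refine ⟨v, hadj, le_antisymm ?_ ?_⟩
    · rw [← hp, SimpleGraph.Walk.length_cons]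
      exact Nat.succ_le_succ (SimpleGraph.dist_le q)
    · have := E.dist_triangle x v d
      rw [SimpleGraph.dist_eq_one_iff_adj.2 hadj] at this
      omega

/-- A walk that leaves a branch passes its connecting node. -/
theorem Environment.conn_mem_support {k : κ} {x d : V} (p : E.graph.Walk x d)
    (hx : x ∈ E.tree k) (hd : d ∉ E.branch k) : E.conn k ∈ p.support := by
  induction p with
  | nil =>
    have : _ ∈ E.main := by_contra fun h => hd ⟨hx, h⟩
    simp [E.eq_conn this hx]
  | @cons u v w hadj q ih =>
    by_cases hu : u ∈ E.main
    · simp [E.eq_conn hu hx]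
    · exact List.mem_cons_of_mem _ (ih (E.mem_tree_of_adj ⟨hx, hu⟩ hadj) hd)

/-- A shortest walk that leaves the tree can be cut at the connecting node. For an agent leaving a
tree, progress to its destination is thus progress to the connecting node. -/
theorem Environment.dist_via_conn {k : κ} {x d : V} (hx : x ∈ E.tree k) (hd : d ∉ E.branch k) :
    E.graph.dist x d = E.graph.dist x (E.conn k) + E.graph.dist (E.conn k) d := by
  classical
  obtain ⟨p, hp⟩ := E.graph_connected.exists_walk_length_eq_dist x d
  have hc := E.conn_mem_support p hx hd
  have h1 := SimpleGraph.dist_le (p.takeUntil _ hc)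
  have h2 := SimpleGraph.dist_le (p.dropUntil _ hc)
  have h3 := congrArg SimpleGraph.Walk.length (p.take_spec hc)
  rw [SimpleGraph.Walk.length_append] at h3
  have := E.dist_triangle x (E.conn k) d
  omega

theorem mem_treeWay_inside {k : κ} {x d v : V} (hd : d ∈ E.branch k) :
    v ∈ treeWay E k x d ↔ v ∈ E.tree k ∧
      E.graph.dist (E.conn k) v + E.graph.dist v d = E.graph.dist (E.conn k) d := by
  simp [treeWay, hd, E.onShortest_iff]

theorem mem_treeWay_outside {k : κ} {x d v : V} (hd : d ∉ E.branch k) :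
    v ∈ treeWay E k x d ↔ v ∈ E.tree k ∧
      E.graph.dist x v + E.graph.dist v d = E.graph.dist x d := by
  simp [treeWay, hd, E.onShortest_iff]

theorem mem_allowed_of_branch {k : κ} {x d v : V} (hx : x ∈ E.branch k) :
    v ∈ allowed E x d ↔ v ∈ treeWay E k x d := by
  constructor
  · rintro (⟨h, -⟩ | ⟨l, hl, hv⟩)
    · exact absurd h hx.2
    · rwa [E.branch_unique hx hl.1]
  · exact fun h => .inr ⟨k, hx, h⟩

theorem mem_allowed_of_main {x d v : V} (hx : x ∈ E.main) :
    v ∈ allowed E x d ↔ v ∈ E.main ∨ ∃ k, d ∈ E.branch k ∧ v ∈ E.branch k ∧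
      v ∈ treeWay E k x d := by
  constructor
  · rintro (⟨-, h⟩ | ⟨l, hl, -⟩)
    · exact h
    · exact absurd hx hl.2
  · exact fun h => .inl ⟨hx, h⟩

/-- The position of an agent is *regular* if, whenever it is in the same tree as the destination, it
lies between the connecting node and the destination. -/
def Regular (x d : V) : Prop :=
  ∀ k, x ∈ E.branch k → d ∈ E.branch k →
    E.graph.dist (E.conn k) x + E.graph.dist x d = E.graph.dist (E.conn k) d

variable {E}

/-- This is the purpose of regularity: staying is among the allowed moves, so a top-level call
cannot fail. -/
theorem Regular.self_mem_allowed {x d : V} (h : Regular E x d) : x ∈ allowed E x d := by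
  rcases E.mem_main_or_branch x with hx | ⟨k, hx⟩
  · exact (mem_allowed_of_main E hx).2 (.inl hx)
  · rw [mem_allowed_of_branch E hx]
    by_cases hd : d ∈ E.branch k
    · exact (mem_treeWay_inside E hd).2 ⟨hx.1, h k hx hd⟩
    · exact (mem_treeWay_outside E hd).2 ⟨hx.1, by simp⟩

/-- Regularity of `x` is not needed: when the tree contains `d`, `treeWay` is measured from the
connecting node, not from `x`. -/
theorem regular_of_mem_allowed {x d v : V} (h : v ∈ allowed E x d) : Regular E v d := by
  intro k hv hd
  rcases h with ⟨-, hm | ⟨l, hl, hvl, hw⟩⟩ | ⟨l, hx, hw⟩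
  · exact absurd hm hv.2
  · obtain rfl := E.branch_unique hv hvl.1
    exact ((mem_treeWay_inside E hd).1 hw).2
  · obtain rfl := E.branch_unique hv hw.1
    exact ((mem_treeWay_inside E hd).1 hw).2

/-- There is an allowed neighbour that is nearer to the destination. -/
theorem Regular.exists_nearer {x d : V} (h : Regular E x d) (hne : x ≠ d) :
    ∃ v, E.graph.Adj x v ∧ v ∈ allowed E x d ∧ E.graph.dist v d + 1 = E.graph.dist x d := by
  obtain ⟨v, hadj, hv⟩ := E.exists_adj_dist hne
  refine ⟨v, hadj, ?_, hv⟩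
  have h1 : E.graph.dist x v = 1 := SimpleGraph.dist_eq_one_iff_adj.2 hadj
  rcases E.mem_main_or_branch x with hx | ⟨k, hx⟩
  · rw [mem_allowed_of_main E hx]
    refine (E.mem_main_or_branch v).imp_right ?_
    rintro ⟨k, hvk⟩
    have hxc := E.eq_conn hx (E.mem_tree_of_adj hvk hadj.symm)
    have hd : d ∈ E.branch k := by
      -- Otherwise the way from `v` to `d` returns through the connecting node `x`, and `v` would be
      -- farther from `d` than `x`.
      by_contra hd
      have := E.dist_via_conn hvk.1 hd
      rw [← hxc] at this
      omega
    refine ⟨k, hd, hvk, (mem_treeWay_inside E hd).2 ⟨hvk.1, ?_⟩⟩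
    rw [← hxc]; omega
  · rw [mem_allowed_of_branch E hx]
    have hvt := E.mem_tree_of_adj hx hadj
    by_cases hd : d ∈ E.branch k
    · refine (mem_treeWay_inside E hd).2 ⟨hvt, ?_⟩
      have := h k hx hd
      have := E.dist_triangle (E.conn k) v d
      have := E.dist_triangle (E.conn k) x v
      omega
    · exact (mem_treeWay_outside E hd).2 ⟨hvt, by omega⟩

/-- In a tree, an allowed neighbour that is nearer to the connecting node. -/
theorem Regular.exists_nearer_conn {k : κ} {x d : V} (h : Regular E x d) (hx : x ∈ E.branch k) :
    ∃ v, E.graph.Adj x v ∧ v ∈ allowed E x d ∧ v ∈ E.tree k ∧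
      E.graph.dist v (E.conn k) + 1 = E.graph.dist x (E.conn k) := by
  obtain ⟨v, hadj, hv⟩ := E.exists_adj_dist
    (show x ≠ E.conn k from fun e => hx.2 (e ▸ (E.conn_mem k).1))
  have h1 : E.graph.dist x v = 1 := SimpleGraph.dist_eq_one_iff_adj.2 hadj
  have hvt := E.mem_tree_of_adj hx hadj
  refine ⟨v, hadj, ?_, hvt, hv⟩
  rw [mem_allowed_of_branch E hx]
  by_cases hd : d ∈ E.branch k
  · refine (mem_treeWay_inside E hd).2 ⟨hvt, ?_⟩
    have := h k hx hd
    have := E.dist_triangle (E.conn k) v d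
    have := E.dist_triangle v x d
    rw [E.graph.dist_comm] at hv
    rw [E.graph.dist_comm (u := x) (v := E.conn k)] at hv
    rw [E.graph.dist_comm (u := v) (v := x)] at this
    omega
  · refine (mem_treeWay_outside E hd).2 ⟨hvt, ?_⟩
    have := E.dist_via_conn hvt hd
    have := E.dist_via_conn hx.1 hd
    omega

end Environment

/-! ### The planning procedure -/

section Planning

variable {V κ A : Type*} {E : Environment V κ} {pos dest : A → V}

theorem Choose.mono {i : A} {C : Set V} {m m' : Memory V A} {b : Bool}
    (h : Choose E pos dest i C m m' b) : m'.U ⊆ m.U ∧ m.O ⊆ m'.O := by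
  induction h with
  | invalid => exact ⟨subset_rfl, subset_rfl⟩
  | vacant => exact ⟨subset_rfl, Set.subset_insert _ _⟩
  | push i C m m' v k hv hmin hk hkv hcall ih =>
    exact ⟨ih.1.trans Set.sdiff_subset, (Set.subset_insert _ _).trans ih.2⟩
  | backtrack i C m m' m'' b v k hv hmin hk hkv hcall hrest ih ih' =>
    exact ⟨ih'.1.trans (ih.1.trans Set.sdiff_subset),
      ((Set.subset_insert _ _).trans ih.2).trans ih'.2⟩

/-- The node of `k` is claimed at the moment when `k` leaves `U`, and by injectivity no other agent
is on it. -/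
theorem insert_avoid (hpos : Function.Injective pos) {U : Set A} {O : Set V} {k : A} {v : V}
    (hkv : pos k = v) (h : ∀ a ∈ U, pos a ∉ O) : ∀ a ∈ U \ {k}, pos a ∉ insert v O := by
  rintro a ⟨ha, hak⟩ (h' | h')
  · exact hak (hpos (h'.trans hkv.symm))
  · exact h a ha h'

/-- Nodes of agents that have not been considered are not claimed. -/
theorem Choose.avoid (hpos : Function.Injective pos) {i : A} {C : Set V} {m m' : Memory V A}
    {b : Bool} (h : Choose E pos dest i C m m' b) :
    (∀ a ∈ m.U, pos a ∉ m.O) → ∀ a ∈ m'.U, pos a ∉ m'.O := by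
  induction h with
  | invalid => exact id
  | vacant i C m v hv hmin hfree =>
    rintro h a ha (h' | h')
    · exact hfree a ha h'
    · exact h a ha h'
  | push i C m m' v k hv hmin hk hkv hcall ih => exact fun h => ih (insert_avoid hpos hkv h)
  | backtrack i C m m' m'' b v k hv hmin hk hkv hcall hrest ih ih' =>
    exact fun h => ih' (ih (insert_avoid hpos hkv h))

theorem Choose.next_eq {i : A} {C : Set V} {m m' : Memory V A} {b : Bool}
    (h : Choose E pos dest i C m m' b) {a : A} : a ∉ m.U → a ≠ i → m'.next a = m.next a := by
  classical
  induction h with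
  | invalid => exact fun _ h => Function.update_of_ne h _ _
  | vacant => exact fun _ h => Function.update_of_ne h _ _
  | push i C m m' v k hv hmin hk hkv hcall ih =>
    intro ha hai
    have : a ≠ k := fun e => ha (e ▸ hk)
    exact (Function.update_of_ne hai _ _).trans (ih (fun h => ha h.1) this)
  | backtrack i C m m' m'' b v k hv hmin hk hkv hcall hrest ih ih' =>
    intro ha hai
    have : a ≠ k := fun e => ha (e ▸ hk)
    exact (ih' (fun h => ha (hcall.mono.1 h).1) hai).trans (ih (fun h => ha h.1) this)

theorem Choose.next_mem {i : A} {C : Set V} {m m' : Memory V A} {b : Bool}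
    (h : Choose E pos dest i C m m' b) : m'.next i = pos i ∨ m'.next i ∈ C := by
  induction h with
  | invalid => simp
  | vacant i C m v hv => simp [hv]
  | push i C m m' v k hv => simp [hv]
  | backtrack i C m m' m'' b v k hv hmin hk hkv hcall hrest ih ih' =>
    exact ih'.imp_right fun h => h.1

variable (E pos dest) in
/-- The next node of every agent is its own one or an allowed neighbour. -/
def LegalMoves (next : A → V) : Prop :=
  ∀ a, next a = pos a ∨ E.graph.Adj (pos a) (next a) ∧ next a ∈ allowed E (pos a) (dest a)

theorem LegalMoves.update [DecidableEq A] {next : A → V} (h : LegalMoves E pos dest next) {i : A}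
    {v : V} (hv : v = pos i ∨ E.graph.Adj (pos i) v ∧ v ∈ allowed E (pos i) (dest i)) :
    LegalMoves E pos dest (Function.update next i v) := by
  intro a
  rcases eq_or_ne a i with rfl | ha
  · simpa using hv
  · simpa [ha] using h a

theorem legal_of_mem_candidates {O : Set V} {i : A} {j : Option A} {v : V}
    (h : v ∈ candidates E pos dest O i j) :
    v = pos i ∨ E.graph.Adj (pos i) v ∧ v ∈ allowed E (pos i) (dest i) :=
  h.1.imp_right fun h' => ⟨h', h.2.2.2⟩

theorem Choose.legalMoves {i : A} {C : Set V} {m m' : Memory V A} {b : Bool}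
    (h : Choose E pos dest i C m m' b) :
    (∀ v ∈ C, v = pos i ∨ E.graph.Adj (pos i) v ∧ v ∈ allowed E (pos i) (dest i)) →
    LegalMoves E pos dest m.next → LegalMoves E pos dest m'.next := by
  classical
  induction h with
  | invalid => exact fun _ h => h.update (.inl rfl)
  | vacant i C m v hv => exact fun hC h => h.update (hC v hv)
  | push i C m m' v k hv hmin hk hkv hcall ih =>
    exact fun hC h => (ih (fun _ => legal_of_mem_candidates) h).update (hC v hv)
  | backtrack i C m m' m'' b v k hv hmin hk hkv hcall hrest ih ih' =>
    exact fun hC h => ih' (fun v hv => hC v hv.1) (ih (fun _ => legal_of_mem_candidates) h)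

/-- A call with answer INVALID leaves all agents that it has considered at their nodes. -/
theorem Choose.stay_of_invalid {i : A} {C : Set V} {m m' : Memory V A} {b : Bool}
    (h : Choose E pos dest i C m m' b) : b = false → i ∉ m.U →
    m'.next i = pos i ∧ ∀ a ∈ m.U, a ∉ m'.U → m'.next a = pos a ∧ pos a ∈ m'.O := by
  induction h with
  | invalid => exact fun _ _ => ⟨by simp, fun a ha ha' => absurd ha ha'⟩
  | vacant => exact fun h => absurd h (by simp)
  | push => exact fun h => absurd h (by simp)
  | backtrack i C m m' m'' b v k hv hmin hk hkv hcall hrest ih ih' =>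
    intro hb hi
    have hi' : i ∉ m'.U := fun h => hi (hcall.mono.1 h).1
    obtain ⟨h1, h2⟩ := ih' hb hi'
    obtain ⟨h3, h4⟩ := ih rfl (fun h => h.2 rfl)
    refine ⟨h1, fun a ha ha' => ?_⟩
    by_cases ham : a ∈ m'.U
    · exact h2 a ham ha'
    · rw [hrest.next_eq ham (fun e => hi (e ▸ ha))]
      rcases eq_or_ne a k with rfl | hak
      · exact ⟨h3, hrest.mono.2 (hcall.mono.2 (.inl hkv))⟩
      · have := h4 a ⟨ha, hak⟩ ham
        exact ⟨this.1, hrest.mono.2 this.2⟩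

/-- After a call with answer INVALID, the newly claimed nodes are occupied, and with each of them
all nodes that its agent could take are claimed, except possibly the node of the caller. -/
theorem Choose.closed_of_invalid {i : A} {C : Set V} {m m' : Memory V A} {b : Bool}
    (h : Choose E pos dest i C m m' b) : b = false →
    C ⊆ m'.O ∧ ∀ v ∈ m'.O, v ∉ m.O → ∃ a ∈ m.U, pos a = v ∧
      ∀ w, E.graph.Adj v w → w ∈ allowed E v (dest a) → w ∈ m'.O ∨ w = pos i := by
  induction h with
  | invalid => exact fun _ => ⟨Set.empty_subset _, fun v h h' => absurd h h'⟩
  | vacant => exact fun h => absurd h (by simp)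
  | push => exact fun h => absurd h (by simp)
  | backtrack i C m m' m'' b v k hv hmin hk hkv hcall hrest ih ih' =>
    intro hb
    obtain ⟨h1, h2⟩ := ih' hb
    obtain ⟨h3, h4⟩ := ih rfl
    have hO : m'.O ⊆ m''.O := hrest.mono.2
    have hvO : insert v m.O ⊆ m'.O := hcall.mono.2
    refine ⟨fun w hw => ?_, fun u hu hum => ?_⟩
    · by_cases hwm : w ∈ m'.O
      · exact hO hwm
      · exact h1 ⟨hw, hwm⟩
    by_cases hum' : u ∈ m'.O
    · rcases eq_or_ne u v with rfl | huv
      · refine ⟨k, hk, hkv, fun w hw ha => ?_⟩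
        by_cases hwO : w ∈ insert u m.O
        · exact .inl (hO (hvO hwO))
        -- The caller's node is barred from the candidates of `k`; this is the only source of the
        -- exception.
        by_cases hwi : w = pos i
        · exact .inr hwi
        refine .inl (hO (h3 ⟨.inr (hkv ▸ hw), hwO, ?_, hkv ▸ ha⟩))
        rintro a ⟨rfl⟩
        exact hwi
      · obtain ⟨a, ha, hau, hcl⟩ := h4 u hum' (by rintro (h | h) <;> contradiction)
        refine ⟨a, ha.1, hau, fun w hw hal => .inl (hO ?_)⟩
        -- The exception of the inner call is the node of `k`, which is `v` and has been claimed.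
        rcases hcl w hw hal with h | rfl
        · exact h
        · exact hvO (.inl hkv)
    · obtain ⟨a, ha, hau, hcl⟩ := h2 u hu hum'
      exact ⟨a, (hcall.mono.1 ha).1, hau, hcl⟩

/-- An agent that may stay at its node gets the answer VALID. -/
theorem Choose.valid_of_self_mem (hpos : Function.Injective pos) {i : A} {C : Set V}
    {m m' : Memory V A} {b : Bool} (h : Choose E pos dest i C m m' b) :
    i ∉ m.U → pos i ∉ m.O → pos i ∈ C → b = true := by
  induction h with
  | invalid => exact fun _ _ h => absurd h (Set.notMem_empty _)
  | vacant => exact fun _ _ _ => rfl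
  | push => exact fun _ _ _ => rfl
  | backtrack i C m m' m'' b v k hv hmin hk hkv hcall hrest ih ih' =>
    -- Nodes newly claimed by the failed call belong to agents of `U`, and `i` is no longer one.
    intro hi hO hC
    have hO' : pos i ∉ m'.O := by
      intro h
      have hiv : pos i ∉ insert v m.O := by
        rintro (h' | h')
        · exact hi (hpos (hkv.trans h'.symm) ▸ hk)
        · exact hO h'
      obtain ⟨a, ha, hai, -⟩ := (hcall.closed_of_invalid rfl).2 _ h hiv
      exact hi (hpos hai ▸ ha.1)
    exact ih' (fun h => hi (hcall.mono.1 h).1) hO' ⟨hC, hO'⟩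

/-- The agents of `D` get distinct new nodes and do not exchange their nodes. -/
def Compatible (pos : A → V) (D : Set A) (next : A → V) : Prop :=
  ∀ a ∈ D, ∀ c ∈ D, a ≠ c → next a ≠ next c ∧ (next a ≠ pos c ∨ next c ≠ pos a)

/-- After a call with answer VALID, the agents that it has considered have newly claimed nodes and
are compatible. -/
theorem Choose.compatible_of_valid (hpos : Function.Injective pos) {i : A} {C : Set V}
    {m m' : Memory V A} {b : Bool} (h : Choose E pos dest i C m m' b) : b = true → i ∉ m.U →
    (∀ a ∈ m.U, pos a ∉ m.O) → (∀ v ∈ C, v ∉ m.O) →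
    (∀ a ∈ insert i (m.U \ m'.U), m'.next a ∈ m'.O ∧ m'.next a ∉ m.O) ∧
      Compatible pos (insert i (m.U \ m'.U)) m'.next := by
  induction h with
  | invalid => exact fun h => absurd h (by simp)
  | vacant i C m v hv hmin hfree =>
    intro _ _ _ hC
    simp only [sdiff_self, Set.bot_eq_empty, insert_empty_eq, Set.mem_singleton_iff]
    refine ⟨?_, ?_⟩
    · rintro a rfl
      simpa using hC v hv
    · rintro a rfl c rfl h
      exact absurd rfl h
  | push i C m m' v k hv hmin hk hkv hcall ih =>
    intro _ hi hU hC
    obtain ⟨h1, h2⟩ := ih rfl (fun h => h.2 rfl) (insert_avoid hpos hkv hU) (fun v h => h.2.1)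
    have hki : k ≠ i := fun e => hi (e ▸ hk)
    have hD : insert k ((m.U \ {k}) \ m'.U) = m.U \ m'.U := by
      ext a
      have : k ∉ m'.U := fun h => (hcall.mono.1 h).2 rfl
      rcases eq_or_ne a k with rfl | h <;> simp_all
    simp only [hD] at h1 h2
    have hne : ∀ a ∈ m.U \ m'.U, a ≠ i := fun a ha e => hi (e ▸ ha.1)
    -- No exchange with the pusher: `k` stays or takes a candidate, and the node of `i` is not a
    -- candidate.
    have hik : m'.next k ≠ pos i := by
      rcases hcall.next_mem with h | h
      · exact fun e => hki (hpos (h.symm.trans e))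
      · exact h.2.2.1 i rfl
    have hi2 : ∀ c ∈ m.U \ m'.U, v ≠ m'.next c ∧ (v ≠ pos c ∨ m'.next c ≠ pos i) := by
      intro c hc
      refine ⟨fun e => (h1 c hc).2 (.inl e.symm), ?_⟩
      rcases eq_or_ne c k with rfl | h
      · exact .inr hik
      · exact .inl fun e => h (hpos (e.symm.trans hkv.symm))
    constructor
    · rintro a (rfl | ha)
      · simpa using ⟨hcall.mono.2 (Set.mem_insert _ _), hC v hv⟩
      · simpa [hne a ha] using ⟨(h1 a ha).1, fun h => (h1 a ha).2 (.inr h)⟩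
    · rintro a (rfl | ha) c (rfl | hc) hac
      · exact absurd rfl hac
      · simpa [hac.symm] using hi2 c hc
      · simpa [hac, ne_comm, or_comm] using hi2 a ha
      · simpa [hne a ha, hne c hc] using h2 a ha c hc hac
  | backtrack i C m m' m'' b v k hv hmin hk hkv hcall hrest ih ih' =>
    intro hb hi hU hC
    have hi' : i ∉ m'.U := fun h => hi (hcall.mono.1 h).1
    obtain ⟨h1, h2⟩ := ih' hb hi' (hcall.avoid hpos (insert_avoid hpos hkv hU)) (fun v h => h.2)
    have hO : m.O ⊆ m'.O := (Set.subset_insert _ _).trans hcall.mono.2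
    obtain ⟨h3, h4⟩ := hcall.stay_of_invalid rfl (fun h => h.2 rfl)
    -- Agents of the failed call stay on claimed nodes, which the remaining candidates avoid.
    have hstay : ∀ a ∈ m.U, a ∉ m'.U → m''.next a = pos a ∧ pos a ∈ m'.O := by
      intro a ha ham
      rw [hrest.next_eq ham (fun e => hi (e ▸ ha))]
      rcases eq_or_ne a k with rfl | hak
      · exact ⟨h3, hcall.mono.2 (.inl hkv)⟩
      · exact h4 a ⟨ha, hak⟩ ham
    have split : ∀ a ∈ insert i (m.U \ m''.U), a ∈ insert i (m'.U \ m''.U) ∨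
        a ∈ m.U ∧ a ∉ m'.U := by
      rintro a (rfl | ha)
      · exact .inl (.inl rfl)
      · by_cases h : a ∈ m'.U
        · exact .inl (.inr ⟨h, ha.2⟩)
        · exact .inr ⟨ha.1, h⟩
    constructor
    · intro a ha
      rcases split a ha with h | h
      · exact ⟨(h1 a h).1, fun h' => (h1 a h).2 (hO h')⟩
      · obtain ⟨e, h'⟩ := hstay a h.1 h.2
        rw [e]
        exact ⟨hrest.mono.2 h', hU a h.1⟩
    · intro a ha c hc hac
      rcases split a ha with h | h <;> rcases split c hc with h' | h'
      · exact h2 a h c h' hac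
      · obtain ⟨e, hm⟩ := hstay c h'.1 h'.2
        rw [e]
        exact ⟨fun e' => (h1 a h).2 (e' ▸ hm), .inr fun e' => hac (hpos e').symm⟩
      · obtain ⟨e, hm⟩ := hstay a h.1 h.2
        rw [e]
        exact ⟨fun e' => (h1 c h').2 (e' ▸ hm), .inl fun e' => hac (hpos e')⟩
      · rw [(hstay a h.1 h.2).1, (hstay c h'.1 h'.2).1]
        exact ⟨fun e' => hac (hpos e'), .inl fun e' => hac (hpos e')⟩

/-! ### The main loop over all agents. -/

variable {pri : A → ℝ}

theorem Drain.next_eq {m m' : Memory V A} (h : Drain E pos dest pri m m') {a : A} :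
    a ∉ m.U → m'.next a = m.next a := by
  induction h with
  | finish => exact fun _ => rfl
  | call m m' m'' i b hi hmax hcall hrest ih =>
    intro ha
    exact (ih fun h => ha (hcall.mono.1 h).1).trans
      (hcall.next_eq (fun h => ha h.1) fun e => ha (e ▸ hi))

theorem Drain.legalMoves {m m' : Memory V A} (h : Drain E pos dest pri m m') :
    LegalMoves E pos dest m.next → LegalMoves E pos dest m'.next := by
  induction h with
  | finish => exact id
  | call m m' m'' i b hi hmax hcall hrest ih =>
    exact fun h => ih (hcall.legalMoves (fun _ => legal_of_mem_candidates) h)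

theorem Drain.compatible (hpos : Function.Injective pos)
    (hself : ∀ a, pos a ∈ allowed E (pos a) (dest a)) {m m' : Memory V A}
    (h : Drain E pos dest pri m m') : (∀ a ∈ m.U, pos a ∉ m.O) → (∀ a ∉ m.U, m.next a ∈ m.O) →
    Compatible pos m.Uᶜ m.next → Compatible pos Set.univ m'.next := by
  induction h with
  | finish m hU => rw [hU, Set.compl_empty]; exact fun _ _ h => h
  | call m m' m'' i b hi hmax hcall hrest ih =>
    intro hU hO hc
    have hU' : ∀ a ∈ m.U \ {i}, pos a ∉ m.O := fun a ha => hU a ha.1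
    -- Top-level calls never fail, since their agents may stay.
    have hb : b = true := hcall.valid_of_self_mem hpos (fun h => h.2 rfl) (hU i hi)
      ⟨.inl rfl, hU i hi, fun a h => by simp at h, hself i⟩
    obtain ⟨h1, h2⟩ := hcall.compatible_of_valid hpos hb (fun h => h.2 rfl) hU' (fun v h => h.2.1)
    have hold : ∀ a ∉ m.U, m'.next a = m.next a := fun a ha =>
      hcall.next_eq (fun h => ha h.1) fun e => ha (e ▸ hi)
    have split : ∀ a ∉ m'.U, a ∉ m.U ∨ a ∈ insert i ((m.U \ {i}) \ m'.U) ∧ a ∈ m.U := by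
      intro a ha
      by_cases h : a ∈ m.U
      · refine .inr ⟨?_, h⟩
        rcases eq_or_ne a i with rfl | hai
        · exact .inl rfl
        · exact .inr ⟨⟨h, hai⟩, ha⟩
      · exact .inl h
    refine ih (hcall.avoid hpos hU') (fun a ha => ?_) (fun a ha c hc' hac => ?_)
    · rcases split a ha with h | h
      · rw [hold a h]
        exact hcall.mono.2 (hO a h)
      · exact (h1 a h.1).1
    · rcases split a ha with h | h <;> rcases split c hc' with h' | h'
      · rw [hold a h, hold c h']
        exact hc a h c h' hac
      · rw [hold a h]
        exact ⟨fun e => (h1 c h'.1).2 (e ▸ hO a h), .inl fun e => hU c h'.2 (e ▸ hO a h)⟩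
      · rw [hold c h']
        exact ⟨fun e => (h1 a h.1).2 (e ▸ hO c h'), .inr fun e => hU a h.2 (e ▸ hO c h')⟩
      · exact h2 a h.1 c h'.1 hac

theorem Step.legalMoves {pos' : A → V} (h : Step E pos dest pri pos') :
    LegalMoves E pos dest pos' := by
  obtain ⟨m, hm, rfl⟩ := h
  exact hm.legalMoves fun a => .inl rfl

theorem Step.compatible (hpos : Function.Injective pos)
    (hself : ∀ a, pos a ∈ allowed E (pos a) (dest a)) {pos' : A → V}
    (h : Step E pos dest pri pos') : Compatible pos Set.univ pos' := by
  obtain ⟨m, hm, rfl⟩ := h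
  exact hm.compatible hpos hself (fun a _ => Set.notMem_empty _)
    (fun a ha => absurd (Set.mem_univ a) ha) fun a ha => absurd (Set.mem_univ a) ha

/-- Some agent of highest priority makes the first call. -/
theorem Step.exists_first [Nonempty A] {pos' : A → V} (h : Step E pos dest pri pos') :
    ∃ i m' b, (∀ a, pri a ≤ pri i) ∧ Choose E pos dest i (candidates E pos dest ∅ i none)
      ⟨Set.univ \ {i}, ∅, pos⟩ m' b ∧ pos' i = m'.next i := by
  obtain ⟨m, hm, rfl⟩ := h
  cases hm with
  | finish _ h => exact absurd h Set.univ_nonempty.ne_empty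
  | call _ m' _ i b hi hmax hcall hrest =>
    exact ⟨i, m', b, fun a => hmax a (Set.mem_univ a), hcall,
      hrest.next_eq fun h => (hcall.mono.1 h).2 rfl⟩

end Planning

/-! ### Progress of the agent of highest priority -/

section Progress

variable {V κ A : Type*} {E : Environment V κ} {pos dest : A → V}

/-- A set of occupied nodes that is closed under the moves allowed to the agents on it, except for
moves to one node `x` that is occupied too, does not meet the main area outside `x`. -/
theorem not_mem_main_of_closed [Finite V] [Fintype A] (hA : Fintype.card A < E.main.ncard)
    {W : Set V} {i : A} (hW : ∀ u ∈ W, ∃ a, pos a = u ∧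
      ∀ w, E.graph.Adj u w → w ∈ allowed E u (dest a) → w ∈ W ∨ w = pos i)
    {u : V} (hu : u ∈ W) (hui : u ≠ pos i) : u ∉ E.main := by
  intro hum
  -- Bi-connectivity is needed if `i` is in the main area; otherwise connectedness suffices.
  have hconn : (E.graph.induce (E.main \ {pos i})).Preconnected := by
    by_cases hx : pos i ∈ E.main
    · exact E.main_biconnected.2 _ hx
    · rw [Set.sdiff_singleton_eq_self hx]
      exact E.main_biconnected.1.preconnected
  have hwalk : ∀ {y z : (E.main \ {pos i} : Set V)},
      (E.graph.induce (E.main \ {pos i})).Walk y z → (y : V) ∈ W → (z : V) ∈ W := by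
    intro y z p
    induction p with
    | nil => exact id
    | @cons y v z hadj q ih =>
      intro hy
      obtain ⟨a, -, hcl⟩ := hW y hy
      exact ih ((hcl v hadj ((mem_allowed_of_main E y.2.1).2 (.inl v.2.1))).resolve_right v.2.2)
  -- Closedness spreads along walks avoiding the node of `i`, so every node of the main area is
  -- occupied.
  have hsub : E.main ⊆ Set.range pos := by
    intro w hw
    by_cases hwi : w = pos i
    · exact ⟨i, hwi.symm⟩
    · obtain ⟨p⟩ := hconn ⟨u, hum, hui⟩ ⟨w, hw, hwi⟩
      obtain ⟨a, ha, -⟩ := hW w (hwalk p hu)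
      exact ⟨a, ha⟩
  have h1 := Set.ncard_le_ncard hsub (Set.toFinite _)
  have h2 : (Set.range pos).ncard ≤ Fintype.card A := by
    rw [← Set.image_univ, ← Nat.card_eq_fintype_card, ← Set.ncard_univ]
    exact Set.ncard_image_le (Set.toFinite _)
  omega

/-- A failed first push yields a closed set of occupied nodes. -/
theorem Choose.closed_of_push_invalid {i k : A} {v : V} (hkv : pos k = v) {U : Set A}
    {m' : Memory V A} (h : Choose E pos dest k (candidates E pos dest (insert v ∅) k (some i))
      ⟨U, insert v ∅, pos⟩ m' false) :
    v ∈ m'.O ∧ ∀ u ∈ m'.O, ∃ a, pos a = u ∧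
      ∀ w, E.graph.Adj u w → w ∈ allowed E u (dest a) → w ∈ m'.O ∨ w = pos i := by
  have hv : v ∈ m'.O := h.mono.2 (.inl rfl)
  obtain ⟨h1, h2⟩ := h.closed_of_invalid rfl
  refine ⟨hv, fun u hu => ?_⟩
  -- The node `v` was claimed before the call, so its closedness comes from the failure of all
  -- candidates of `k`.
  rcases eq_or_ne u v with rfl | huv
  · refine ⟨k, hkv, fun w hw hal => ?_⟩
    by_cases hwi : w = pos i
    · exact .inr hwi
    refine .inl (h1 ⟨.inr (hkv ▸ hw), ?_, ?_, hkv ▸ hal⟩)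
    · rintro (h | h)
      · exact hw.ne h.symm
      · exact h
    · rintro a ⟨rfl⟩
      exact hwi
  · obtain ⟨a, -, ha, hcl⟩ := h2 u hu (by rintro (h | h) <;> contradiction)
    refine ⟨a, ha, fun w hw hal => .inl ?_⟩
    rcases hcl w hw hal with h | rfl
    · exact h
    · rwa [hkv]

/-- An agent in a tree can be pushed deeper, as all agents in that tree head for places in it that
they have not reached. -/
theorem exists_deeper {l : κ} {i k : A} {v : V} {O : Set V} (hkv : pos k = v)
    (hl : v ∈ E.branch l) (hd : dest k ∈ E.branch l) (hreg : Regular E v (dest k))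
    (hne : v ≠ dest k) (hO : ∀ w ∈ O, E.graph.dist (E.conn l) w ≤ E.graph.dist (E.conn l) v)
    (hi : E.graph.dist (E.conn l) (pos i) ≤ E.graph.dist (E.conn l) v) :
    ∃ u ∈ candidates E pos dest O k (some i),
      E.graph.dist u (dest k) < E.graph.dist v (dest k) := by
  obtain ⟨u, hadj, hal, hu⟩ := hreg.exists_nearer hne
  have h1 := hreg l hl hd
  have h2 := ((mem_treeWay_inside E hd).1 ((mem_allowed_of_branch E hl).1 hal)).2
  refine ⟨u, ⟨.inr (hkv ▸ hadj), fun h => ?_, ?_, hkv ▸ hal⟩, by omega⟩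
  · have := hO u h
    omega
  · rintro a ⟨rfl⟩ rfl
    omega

/-- All claimed nodes are at most as deep as the pushed agent, so its next node towards its
destination is unclaimed. The best candidate is therefore strictly deeper, and an agent found there
is in the same situation. By induction on the call, pushing it cannot fail. -/
theorem Choose.valid_of_deeper {l : κ}
    (hin : ∀ a, pos a ∈ E.branch l → dest a ∈ E.branch l ∧ Regular E (pos a) (dest a) ∧
      pos a ≠ dest a) {i : A} {C : Set V}
    {m m' : Memory V A} {b : Bool} (h : Choose E pos dest i C m m' b) : pos i ∈ E.branch l →
    (∃ u ∈ C, E.graph.dist u (dest i) < E.graph.dist (pos i) (dest i)) →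
    (∀ u ∈ C, u ∈ allowed E (pos i) (dest i)) →
    (∀ w ∈ m.O, E.graph.dist (E.conn l) w ≤ E.graph.dist (E.conn l) (pos i)) → b = true := by
  induction h with
  | invalid => rintro - ⟨u, hu, -⟩; exact absurd hu (Set.notMem_empty _)
  | vacant => exact fun _ _ _ _ => rfl
  | push => exact fun _ _ _ _ => rfl
  | backtrack i C m m' m'' b v k hv hmin hk hkv hcall hrest ih ih' =>
    rintro hi ⟨u, hu, hlt⟩ hal hO
    obtain ⟨hd, hreg, -⟩ := hin i hi
    have h1 := hreg l hi hd
    obtain ⟨hvt, h2⟩ :=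
      (mem_treeWay_inside E hd).1 ((mem_allowed_of_branch E hi).1 (hal v hv))
    have h3 := hmin u hu
    have hvl : v ∈ E.branch l := by
      -- Both nodes lie on shortest paths from the connecting node to the destination, so nearer to
      -- the destination means strictly deeper.
      refine ⟨hvt, fun hvm => ?_⟩
      have : E.graph.dist (E.conn l) v = 0 := by
        rw [E.eq_conn hvm hvt, SimpleGraph.dist_self]
      omega
    obtain ⟨hkd, hkreg, hkne⟩ := hin k (hkv ▸ hvl)
    have hO' : ∀ w ∈ insert v m.O, E.graph.dist (E.conn l) w ≤ E.graph.dist (E.conn l) v := by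
      rintro w (rfl | hw)
      · exact le_rfl
      · have := hO w hw
        omega
    subst hkv
    exact absurd (ih hvl (exists_deeper rfl hvl hkd hkreg hkne hO' (by omega))
      (fun u hu => hu.2.2.2) hO') (by simp)

/-- If the first push cannot fail, an agent that makes the first call gets nearer to its
destination. -/
theorem Choose.first_nearer {i : A} {C : Set V} {m m' : Memory V A} {b : Bool}
    (h : Choose E pos dest i C m m' b)
    (hC : ∃ u ∈ C, E.graph.dist u (dest i) < E.graph.dist (pos i) (dest i))
    (hpush : ∀ v ∈ C, E.graph.dist v (dest i) < E.graph.dist (pos i) (dest i) →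
      ∀ k ∈ m.U, pos k = v → ∀ m₁, ¬ Choose E pos dest k
        (candidates E pos dest (insert v m.O) k (some i))
        ⟨m.U \ {k}, insert v m.O, m.next⟩ m₁ false) :
    E.graph.dist (m'.next i) (dest i) < E.graph.dist (pos i) (dest i) := by
  obtain ⟨u, hu, hlt⟩ := hC
  cases h with
  | invalid => exact absurd hu (Set.notMem_empty _)
  | vacant _ _ _ v hv hmin => simpa using (hmin u hu).trans_lt hlt
  | push _ _ _ _ v k hv hmin => simpa using (hmin u hu).trans_lt hlt
  | backtrack _ _ _ m₁ _ _ v k hv hmin hk hkv hcall =>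
    exact absurd hcall (hpush v hv ((hmin u hu).trans_lt hlt) k hk hkv m₁)

/-- The first agent gets nearer to its destination if it is in a tree that does not contain it. -/
theorem Choose.first_nearer_of_outside [Finite V] [Fintype A]
    (hA : Fintype.card A < E.main.ncard) (hreg : ∀ a, Regular E (pos a) (dest a)) {i : A} {l : κ}
    (hi : pos i ∈ E.branch l) (hd : dest i ∉ E.branch l) {m' : Memory V A} {b : Bool}
    (h : Choose E pos dest i (candidates E pos dest ∅ i none) ⟨Set.univ \ {i}, ∅, pos⟩ m' b) :
    E.graph.dist (m'.next i) (dest i) < E.graph.dist (pos i) (dest i) := by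
  obtain ⟨u, hadj, hal, hu⟩ := (hreg i).exists_nearer fun e => hd (e ▸ hi)
  refine h.first_nearer ⟨u, ⟨.inr hadj, Set.notMem_empty _, by simp, hal⟩, by omega⟩ ?_
  intro v hv hlt k hk hkv m₁ hcall
  obtain ⟨hvO, hW⟩ := hcall.closed_of_push_invalid hkv
  have hvt := ((mem_treeWay_outside E hd).1 ((mem_allowed_of_branch E hi).1 hv.2.2.2)).1
  have hx := E.dist_via_conn hi.1 hd
  -- Every agent in the tree may be pushed towards the connecting node, so the closed set reaches
  -- it. The strict bound keeps this descent away from the node of `i`.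
  have key : ∀ n, ∀ w ∈ m₁.O, w ∈ E.tree l → E.graph.dist w (E.conn l) = n →
      n < E.graph.dist (pos i) (E.conn l) → False := by
    intro n
    induction n with
    | zero =>
      intro w hw hwt h0 hlt
      have hc : w = E.conn l := E.graph_connected.dist_eq_zero_iff.1 h0
      refine not_mem_main_of_closed hA hW hw ?_ (hc ▸ (E.conn_mem l).1)
      rintro rfl
      omega
    | succ n ih =>
      intro w hw hwt hn hlt
      have hwl : w ∈ E.branch l := by
        refine ⟨hwt, fun hm => ?_⟩
        rw [E.eq_conn hm hwt, SimpleGraph.dist_self] at hn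
        omega
      obtain ⟨a, rfl, hcl⟩ := hW w hw
      obtain ⟨z, hz, hzal, hzt, hzd⟩ := (hreg a).exists_nearer_conn hwl
      rcases hcl z hz hzal with h | rfl
      · exact ih z h hzt (by omega) (by omega)
      · omega
  have hvd := E.dist_via_conn hvt hd
  exact key _ v hvO hvt rfl (by omega)

/-- The first agent gets nearer to its destination if no agent is in a tree that does not contain
its destination, and agents in trees have not reached their destinations. -/
theorem Choose.first_nearer_of_inside [Finite V] [Fintype A]
    (hA : Fintype.card A < E.main.ncard) (hreg : ∀ a, Regular E (pos a) (dest a))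
    (hin : ∀ a l, pos a ∈ E.branch l → dest a ∈ E.branch l ∧ pos a ≠ dest a) {i : A}
    (hne : pos i ≠ dest i) {m' : Memory V A} {b : Bool}
    (h : Choose E pos dest i (candidates E pos dest ∅ i none) ⟨Set.univ \ {i}, ∅, pos⟩ m' b) :
    E.graph.dist (m'.next i) (dest i) < E.graph.dist (pos i) (dest i) := by
  obtain ⟨u, hadj, hal, hu⟩ := (hreg i).exists_nearer hne
  refine h.first_nearer ⟨u, ⟨.inr hadj, Set.notMem_empty _, by simp, hal⟩, by omega⟩ ?_
  intro v hv hlt k hk hkv m₁ hcall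
  have hvi : v ≠ pos i := by rintro rfl; omega
  have hdeep : ∀ l, v ∈ E.branch l →
      E.graph.dist (E.conn l) (pos i) ≤ E.graph.dist (E.conn l) v → False := by
    intro l hvl hle
    subst hkv
    have hO : ∀ w ∈ insert (pos k) (∅ : Set V),
        E.graph.dist (E.conn l) w ≤ E.graph.dist (E.conn l) (pos k) := by
      rintro w (rfl | hw)
      · exact le_rfl
      · exact absurd hw (Set.notMem_empty _)
    exact absurd (hcall.valid_of_deeper (l := l)
      (fun a ha => ⟨(hin a l ha).1, hreg a, (hin a l ha).2⟩) hvl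
      (exists_deeper rfl hvl (hin k l hvl).1 (hreg k) (hin k l hvl).2 hO hle)
      (fun u hu => hu.2.2.2) hO) (by simp)
  rcases E.mem_main_or_branch v with hvm | ⟨l, hvl⟩
  · obtain ⟨hvO, hW⟩ := hcall.closed_of_push_invalid hkv
    exact not_mem_main_of_closed hA hW hvO hvi hvm
  · have hadj' : E.graph.Adj (pos i) v := hv.1.resolve_left hvi
    -- The agent enters the tree at its connecting node, of depth 0, or is in that tree already and
    -- moves deeper.
    rcases E.mem_main_or_branch (pos i) with hm | ⟨l', hl'⟩
    · refine hdeep l hvl ?_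
      rw [E.eq_conn hm (E.mem_tree_of_adj hvl hadj'.symm)]
      simp
    · obtain rfl := E.branch_unique hvl (E.mem_tree_of_adj hl' hadj')
      have hd := (hin i l hl').1
      have h1 := hreg i l hl' hd
      have h2 := ((mem_treeWay_inside E hd).1 ((mem_allowed_of_branch E hl').1 hv.2.2.2)).2
      exact hdeep l hvl (by omega)

end Progress

/-! ### Agents in trees that do not contain their destinations -/

section Misplaced

variable {V κ : Type*} (E : Environment V κ)

open Classical in
/-- The distance to the main area. -/
noncomputable def Environment.depth (v : V) : ℕ :=
  if h : ∃ k, v ∈ E.branch k then E.graph.dist v (E.conn h.choose) else 0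

theorem Environment.depth_eq {k : κ} {v : V} (h : v ∈ E.branch k) :
    E.depth v = E.graph.dist v (E.conn k) := by
  have hex : ∃ k, v ∈ E.branch k := ⟨k, h⟩
  rw [depth, dif_pos hex, E.branch_unique hex.choose_spec h.1]

/-- An agent at `x` with destination `d` is in a tree that does not contain `d`. -/
def Misplaced (x d : V) : Prop := ∃ k, x ∈ E.branch k ∧ d ∉ E.branch k

open Classical in
/-- The distance to the main area for a misplaced agent, and `0` for other agents. -/
noncomputable def misplacement (x d : V) : ℕ := if Misplaced E x d then E.depth x else 0

variable {E}

theorem Misplaced.misplacement_pos {x d : V} (h : Misplaced E x d) : 0 < misplacement E x d := by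
  rw [misplacement, if_pos h]
  obtain ⟨k, hk, -⟩ := h
  rw [E.depth_eq hk]
  exact E.graph_connected.pos_dist_of_ne fun e => hk.2 (e ▸ (E.conn_mem k).1)

/-- An agent enters only trees containing its destination, and in other trees it moves only on a
shortest way out; being pushed does not set it back. A changing parking node does no harm, as it
stays in the main area. -/
theorem misplacement_step {x y d d' : V}
    (hmove : y = x ∨ E.graph.Adj x y ∧ y ∈ allowed E x d)
    (hd : d' = d ∨ d ∈ E.main ∧ d' ∈ E.main) :
    misplacement E y d' ≤ misplacement E x d ∧
      (Misplaced E x d → E.graph.dist y d < E.graph.dist x d →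
        misplacement E y d' < misplacement E x d) := by
  by_cases hy : Misplaced E y d'
  swap
  · rw [misplacement, if_neg hy]
    exact ⟨Nat.zero_le _, fun h _ => h.misplacement_pos⟩
  obtain ⟨k, hyk, hdk'⟩ := id hy
  have hdk : d ∉ E.branch k := by
    rcases hd with rfl | hd
    · exact hdk'
    · exact fun h => h.2 hd.1
  have hxk : x ∈ E.branch k ∧ E.graph.dist y d ≤ E.graph.dist x d := by
    rcases hmove with rfl | ⟨hadj, ⟨hx, hm | ⟨l, hl, hyl, -⟩⟩ | ⟨l, hxl, hw⟩⟩
    · exact ⟨hyk, le_rfl⟩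
    · exact absurd hm hyk.2
    · exact absurd (E.branch_unique hyk hyl.1 ▸ hl) hdk
    · obtain rfl := E.branch_unique hyk hw.1
      have := ((mem_treeWay_outside E hdk).1 hw).2
      exact ⟨hxl, by omega⟩
  have hx : Misplaced E x d := ⟨k, hxk.1, hdk⟩
  rw [misplacement, misplacement, if_pos hy, if_pos hx, E.depth_eq hyk, E.depth_eq hxk.1]
  have h1 := E.dist_via_conn hyk.1 hdk
  have h2 := E.dist_via_conn hxk.1.1 hdk
  exact ⟨by omega, fun _ _ => by omega⟩

end Misplaced

/-! ### Executions -/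

/-! ### Loading and unloading. -/

section Jobs

variable {V ι : Type*} {s g : ι → V} {v : V} {τ : ι}

theorem arrive_eq_toPickup {j : Job ι} (h : arrive s g v j = .toPickup τ) :
    j = .toPickup τ ∧ v ≠ s τ := by
  cases j <;> simp only [arrive] at h
  case free => simp at h
  all_goals split_ifs at h <;> simp_all

theorem arrive_eq_toDelivery {j : Job ι} (h : arrive s g v j = .toDelivery τ) :
    v ≠ g τ ∧ (j = .toDelivery τ ∨ j = .toPickup τ ∧ v = s τ) := by
  cases j <;> simp only [arrive] at h
  case free => simp at h
  all_goals (split_ifs at h; simp_all)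

/-- The number of arrivals that complete a job. -/
def Job.rank : Job ι → ℕ
  | .free => 0
  | .toPickup _ => 2
  | .toDelivery _ => 1

theorem rank_arrive_le (s g : ι → V) (v : V) (j : Job ι) :
    (arrive s g v j).rank ≤ j.rank ∧ ((arrive s g v j).rank = j.rank → arrive s g v j = j) := by
  cases j <;> simp only [arrive]
  case free => simp
  all_goals split_ifs <;> simp [Job.rank]

end Jobs

section Execution

variable {V κ A ι : Type*} [Fintype V] {E : Environment V κ} {s g : ι → V}
  (r : Execution E s g A)

/-- The current destination of an agent. -/
def Execution.dest (t : ℕ) (a : A) : V := destination s g (r.park t a) (r.job t a)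

theorem Execution.exists_job_eq_arrive (t : ℕ) (a : A) :
    ∃ j, r.job t a = arrive s g (r.pos t a) j := by
  rw [r.job_eq]
  cases r.assign t a with
  | some τ => exact ⟨.toPickup τ, rfl⟩
  | none =>
    cases t with
    | zero => exact ⟨.free, r.held_zero a⟩
    | succ t => exact ⟨_, r.held_succ t a⟩

theorem Execution.job_succ {t : ℕ} {a : A} (h : r.assign (t + 1) a = none) :
    r.job (t + 1) a = arrive s g (r.pos (t + 1) a) (r.job t a) := by
  rw [r.job_eq, h, take, r.held_succ]

/-- Loading and unloading precede planning, also for a task just given, so a job that persists has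
not reached its destination. -/
theorem Execution.pos_ne_dest {t : ℕ} {a : A} (h : r.job t a ≠ .free) :
    r.pos t a ≠ r.dest t a := by
  obtain ⟨j, hj⟩ := r.exists_job_eq_arrive t a
  rw [dest]
  cases hjob : r.job t a with
  | free => exact absurd hjob h
  | toPickup τ => exact (arrive_eq_toPickup (hj.symm.trans hjob)).2
  | toDelivery τ => exact (arrive_eq_toDelivery (hj.symm.trans hjob)).1

theorem Execution.dest_mem_main {t : ℕ} {a : A} (h : r.job t a = .free) :
    r.dest t a ∈ E.main := by
  rw [dest, h]
  exact r.park_main t a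

theorem Execution.legalMoves (t : ℕ) : LegalMoves E (r.pos t) (r.dest t) (r.pos (t + 1)) :=
  (r.step t).legalMoves

/-- Allowed moves preserve regularity for a fixed destination. A new destination is a parking node
in the main area, a pickup node outside the current tree (`hA3`), or a delivery node outside the
tree of the pickup node just reached (`hA2`); in each case the condition is vacuous. -/
theorem Execution.regular (hA2 : ∀ τ k, ¬ (s τ ∈ E.branch k ∧ g τ ∈ E.branch k))
    (hA3 : ∀ t a τ k, r.assign t a = some τ → r.pos t a ∈ E.branch k → s τ ∉ E.branch k)
    (t : ℕ) (a : A) : Regular E (r.pos t a) (r.dest t a) := by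
  have hfree : ∀ t, r.job t a = .free → Regular E (r.pos t a) (r.dest t a) :=
    fun t h k _ hd => absurd (r.dest_mem_main h) hd.2
  have hassign : ∀ t τ, r.assign t a = some τ → Regular E (r.pos t a) (r.dest t a) := by
    intro t τ h k hx hd
    have hs := hA3 t a τ k h hx
    have hne : r.pos t a ≠ s τ := fun e => hs (e ▸ hx)
    have hj : r.job t a = .toPickup τ := by
      rw [r.job_eq, h]
      simp [take, arrive, hne]
    rw [dest, hj] at hd
    exact absurd hd hs
  induction t with
  | zero =>
    cases h : r.assign 0 a with
    | some τ => exact hassign 0 τ h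
    | none => exact hfree 0 (by rw [r.job_eq, h, take, r.held_zero])
  | succ t ih =>
    cases h : r.assign (t + 1) a with
    | some τ => exact hassign (t + 1) τ h
    | none =>
      have hj := r.job_succ h
      have hstep : Regular E (r.pos (t + 1) a) (r.dest t a) := by
        rcases r.legalMoves t a with e | ⟨-, hal⟩
        · rwa [e]
        · exact regular_of_mem_allowed hal
      cases hjob : r.job (t + 1) a with
      | free => exact hfree _ hjob
      | toPickup τ =>
        have h1 := (arrive_eq_toPickup (hj.symm.trans hjob)).1
        rw [dest, hjob]
        rwa [dest, h1] at hstep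
      | toDelivery τ =>
        rcases (arrive_eq_toDelivery (hj.symm.trans hjob)).2 with h1 | ⟨-, h1⟩
        · rw [dest, hjob]
          rwa [dest, h1] at hstep
        · intro k hx hd
          rw [dest, hjob] at hd
          exact absurd ⟨h1 ▸ hx, hd⟩ (hA2 τ k)

theorem Execution.compatible (hreg : ∀ t a, Regular E (r.pos t a) (r.dest t a)) (t : ℕ) :
    Function.Injective (r.pos t) ∧ Compatible (r.pos t) Set.univ (r.pos (t + 1)) := by
  have hstep : ∀ t, Function.Injective (r.pos t) →
      Compatible (r.pos t) Set.univ (r.pos (t + 1)) := fun t h =>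
    (r.step t).compatible h fun a => (hreg t a).self_mem_allowed
  induction t with
  | zero => exact ⟨r.pos_zero_injective, hstep 0 r.pos_zero_injective⟩
  | succ t ih =>
    have hinj : Function.Injective (r.pos (t + 1)) := fun a b hab => by
      by_contra hne
      exact (ih.2 a trivial b trivial hne).1 hab
    exact ⟨hinj, hstep _ hinj⟩

theorem Execution.collisionFree (hreg : ∀ t a, Regular E (r.pos t a) (r.dest t a)) :
    CollisionFree E.graph r.pos := by
  refine ⟨fun t a => (r.legalMoves t a).imp_right fun h => h.1,
    fun t a b hab e => hab ((r.compatible hreg t).1 e), fun t a b hab => ?_⟩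
  rcases ((r.compatible hreg t).2 a trivial b trivial hab).2 with h | h
  · exact .inr h
  · exact .inl h.symm

/-- The priority with which an agent plans. -/
noncomputable def Execution.pri (t : ℕ) (a : A) : ℝ :=
  priority E (r.pos t a) (r.dest t a) (r.eps t a) (r.job t a)

theorem Execution.pri_of_misplaced {t : ℕ} {a : A} (h : Misplaced E (r.pos t a) (r.dest t a)) :
    r.pri t a = 1 + r.eps t a := by
  unfold pri priority
  exact if_pos h

theorem Execution.pri_of_free {t : ℕ} {a : A} (h : ¬ Misplaced E (r.pos t a) (r.dest t a))
    (hj : r.job t a = .free) : r.pri t a = -(Fintype.card V : ℝ) + r.eps t a := by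
  unfold pri priority
  rw [hj]
  exact if_neg h

theorem Execution.pri_of_task {t : ℕ} {a : A} (h : ¬ Misplaced E (r.pos t a) (r.dest t a))
    (hj : r.job t a ≠ .free) :
    r.pri t a = -(E.graph.dist (r.pos t a) (r.dest t a) : ℝ) + r.eps t a := by
  unfold pri priority
  refine (if_neg h).trans ?_
  cases hjob : r.job t a with
  | free => exact absurd hjob hj
  | toPickup τ => rfl
  | toDelivery τ => rfl

theorem Execution.exists_first [Nonempty A] (t : ℕ) : ∃ i m' b, (∀ a, r.pri t a ≤ r.pri t i) ∧
    Choose E (r.pos t) (r.dest t) i (candidates E (r.pos t) (r.dest t) ∅ i none)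
      ⟨Set.univ \ {i}, ∅, r.pos t⟩ m' b ∧ r.pos (t + 1) i = m'.next i :=
  (r.step t).exists_first

/-- As long as there are misplaced agents, one of them gets nearer to its destination. -/
theorem Execution.exists_misplaced_nearer [Fintype A] [Nonempty A]
    (hA : Fintype.card A < E.main.ncard) {t : ℕ}
    (hreg : ∀ a, Regular E (r.pos t a) (r.dest t a))
    (h : ∃ a, Misplaced E (r.pos t a) (r.dest t a)) :
    ∃ i, Misplaced E (r.pos t i) (r.dest t i) ∧
      E.graph.dist (r.pos (t + 1) i) (r.dest t i) < E.graph.dist (r.pos t i) (r.dest t i) := by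
  obtain ⟨i, m', b, hmax, hcall, hi⟩ := r.exists_first t
  have hmis : Misplaced E (r.pos t i) (r.dest t i) := by
    obtain ⟨a, ha⟩ := h
    -- Misplaced agents have priority above 1, all others below 1.
    by_contra hn
    have h1 := hmax a
    rw [r.pri_of_misplaced ha] at h1
    have h2 := r.eps_pos t a
    have h3 := r.eps_lt_one t i
    by_cases hj : r.job t i = .free
    · rw [r.pri_of_free hn hj] at h1
      have : (0 : ℝ) ≤ Fintype.card V := Nat.cast_nonneg _
      linarith
    · rw [r.pri_of_task hn hj] at h1
      have : (0 : ℝ) ≤ E.graph.dist (r.pos t i) (r.dest t i) := Nat.cast_nonneg _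
      linarith
  obtain ⟨l, hl, hd⟩ := id hmis
  exact ⟨i, hmis, hi ▸ hcall.first_nearer_of_outside hA hreg hl hd⟩

/-- If there are no misplaced agents, a nearest one among the agents with a task gets nearer to its
destination. -/
theorem Execution.exists_task_nearer [Fintype A] [Nonempty A]
    (hA : Fintype.card A < E.main.ncard) {t : ℕ}
    (hreg : ∀ a, Regular E (r.pos t a) (r.dest t a))
    (hmis : ∀ a, ¬ Misplaced E (r.pos t a) (r.dest t a)) (h : ∃ a, r.job t a ≠ .free) :
    ∃ i, r.job t i ≠ .free ∧ (∀ a, r.job t a ≠ .free →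
        E.graph.dist (r.pos t i) (r.dest t i) ≤ E.graph.dist (r.pos t a) (r.dest t a)) ∧
      E.graph.dist (r.pos (t + 1) i) (r.dest t i) < E.graph.dist (r.pos t i) (r.dest t i) := by
  obtain ⟨i, m', b, hmax, hcall, hi⟩ := r.exists_first t
  have hji : r.job t i ≠ .free := by
    intro hj
    obtain ⟨a, ha⟩ := h
    have h1 := hmax a
    rw [r.pri_of_free (hmis i) hj, r.pri_of_task (hmis a) ha] at h1
    have h2 := r.eps_pos t a
    have h3 := r.eps_lt_one t i
    -- A shortest path repeats no node. Hence agents with a task have priority above 1 - |V|, and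
    -- free ones outside foreign trees are below it.
    have h4 : E.graph.dist (r.pos t a) (r.dest t a) + 1 ≤ Fintype.card V := by
      obtain ⟨p, hp, hl⟩ := E.graph_connected.exists_path_of_dist (r.pos t a) (r.dest t a)
      exact hl ▸ hp.length_lt
    have h5 : (E.graph.dist (r.pos t a) (r.dest t a) : ℝ) + 1 ≤ Fintype.card V := by
      exact_mod_cast h4
    linarith
  refine ⟨i, hji, fun a ha => ?_, hi ▸ hcall.first_nearer_of_inside hA hreg ?_
    (r.pos_ne_dest hji)⟩
  · have h1 := hmax a
    rw [r.pri_of_task (hmis i) hji, r.pri_of_task (hmis a) ha] at h1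
    have h2 := r.eps_pos t a
    have h3 := r.eps_lt_one t i
    -- Distances are integers and the random numbers differ by less than 1, so they only break ties.
    by_contra! hlt
    have : (E.graph.dist (r.pos t a) (r.dest t a) : ℝ) + 1 ≤
        E.graph.dist (r.pos t i) (r.dest t i) := by exact_mod_cast hlt
    linarith
  · intro a l hl
    have hd : r.dest t a ∈ E.branch l := by_contra fun hd => hmis a ⟨l, hl, hd⟩
    exact ⟨hd, r.pos_ne_dest fun hj => hd.2 (r.dest_mem_main hj)⟩

/-- The least distance of an agent with a task to its destination. -/
noncomputable def Execution.minDist (t : ℕ) : ℕ :=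
  sInf {n | ∃ a, r.job t a ≠ .free ∧ E.graph.dist (r.pos t a) (r.dest t a) = n}

/-- A quantity that decreases as long as no tasks are given and work is left: arrivals to come, the
way of misplaced agents to the main area, the distance of a nearest agent to its destination. -/
noncomputable def Execution.remaining [Fintype A] (t : ℕ) : ℕ ×ₗ ℕ ×ₗ ℕ :=
  toLex (∑ a, (r.job t a).rank,
    toLex (∑ a, misplacement E (r.pos t a) (r.dest t a), r.minDist t))

/-- An arrival lowers the first component. Without arrivals jobs are unchanged; a misplaced agent
then lowers the second, or, if there is none, a nearest agent with a task lowers the third. The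
nearest agent may vary, as only the minimum counts. -/
theorem Execution.remaining_lt [Fintype A] [Nonempty A] (hA : Fintype.card A < E.main.ncard) {t : ℕ}
    (hreg : ∀ a, Regular E (r.pos t a) (r.dest t a)) (hassign : ∀ a, r.assign (t + 1) a = none)
    (hwork : ¬ ∀ a, r.job t a = .free ∧ r.pos t a ∈ E.main) :
    r.remaining (t + 1) < r.remaining t := by
  have hrank := fun a => rank_arrive_le s g (r.pos (t + 1) a) (r.job t a)
  simp only [← r.job_succ (hassign _)] at hrank
  have hsum : ∑ a, (r.job (t + 1) a).rank ≤ ∑ a, (r.job t a).rank :=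
    Finset.sum_le_sum fun a _ => (hrank a).1
  rw [remaining, remaining, Prod.Lex.toLex_lt_toLex, Prod.Lex.toLex_lt_toLex]
  refine hsum.lt_or_eq.imp_right fun heq => ⟨heq, ?_⟩
  have hjob : ∀ a, r.job (t + 1) a = r.job t a := fun a => (hrank a).2
    ((Finset.sum_eq_sum_iff_of_le fun a _ => (hrank a).1).1 heq a (Finset.mem_univ a))
  have hdest : ∀ a, r.job t a ≠ .free → r.dest (t + 1) a = r.dest t a := by
    intro a ha
    rw [dest, dest, hjob a]
    cases h : r.job t a with
    | free => exact absurd h ha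
    | toPickup τ => rfl
    | toDelivery τ => rfl
  have hstep := fun a => misplacement_step (d' := r.dest (t + 1) a) (r.legalMoves t a) <| by
    by_cases h : r.job t a = .free
    · exact .inr ⟨r.dest_mem_main h, r.dest_mem_main ((hjob a).trans h)⟩
    · exact .inl (hdest a h)
  by_cases hmis : ∃ a, Misplaced E (r.pos t a) (r.dest t a)
  · obtain ⟨i, hi, hlt⟩ := r.exists_misplaced_nearer hA hreg hmis
    exact .inl (Finset.sum_lt_sum (fun a _ => (hstep a).1)
      ⟨i, Finset.mem_univ i, (hstep i).2 hi hlt⟩)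
  push Not at hmis
  have hmis0 : ∀ a, misplacement E (r.pos t a) (r.dest t a) = 0 := fun a => if_neg (hmis a)
  have hmis1 : ∀ a, misplacement E (r.pos (t + 1) a) (r.dest (t + 1) a) = 0 := fun a =>
    Nat.le_zero.1 (hmis0 a ▸ (hstep a).1)
  refine .inr ⟨by simp [hmis0, hmis1], ?_⟩
  have htask : ∃ a, r.job t a ≠ .free := by
    by_contra! hfree
    refine hwork fun a => ⟨hfree a, (E.mem_main_or_branch _).resolve_right ?_⟩
    rintro ⟨k, hk⟩
    exact hmis a ⟨k, hk, fun h => h.2 (r.dest_mem_main (hfree a))⟩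
  obtain ⟨i, hji, hmin, hlt⟩ := r.exists_task_nearer hA hreg hmis htask
  -- The agent `i` has a task at both timesteps, so neither infimum is over the empty set.
  have hle : r.minDist (t + 1) ≤ E.graph.dist (r.pos (t + 1) i) (r.dest (t + 1) i) :=
    Nat.sInf_le ⟨i, (hjob i).trans_ne hji, rfl⟩
  rw [hdest i hji] at hle
  obtain ⟨a, ha, he⟩ := Nat.sInf_mem (s := {n | ∃ a, r.job t a ≠ .free ∧
    E.graph.dist (r.pos t a) (r.dest t a) = n}) ⟨_, i, hji, rfl⟩
  exact (hle.trans_lt hlt).trans_le ((hmin a ha).trans he.le)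

/-- When no more tasks are given, all agents become free and gather in the main area. -/
theorem Execution.exists_idle [Fintype A] [Nonempty A] (hA : Fintype.card A < E.main.ncard)
    (hreg : ∀ t a, Regular E (r.pos t a) (r.dest t a)) {t₀ : ℕ}
    (hassign : ∀ t ≥ t₀, ∀ a, r.assign t a = none) :
    ∃ t ≥ t₀, ∀ a, r.job t a = .free ∧ r.pos t a ∈ E.main := by
  by_contra! hno
  have hlt : ∀ n, r.remaining (t₀ + n + 1) < r.remaining (t₀ + n) := fun n =>
    r.remaining_lt hA (hreg _) (hassign _ (by omega)) fun h => by
      obtain ⟨a, ha⟩ := hno (t₀ + n) (by omega)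
      exact ha (h a).1 (h a).2
  obtain ⟨n, hn⟩ := WellFounded.not_rel_apply_succ (r := (· < ·)) fun n => r.remaining (t₀ + n)
  exact hn (hlt n)

/-! ### From assignment to completion of a task. -/

theorem Execution.exists_assign_eq_none [Finite ι] : ∃ t₀, ∀ t ≥ t₀, ∀ a, r.assign t a = none := by
  have hfin : {t | ∃ a, r.assign t a ≠ none}.Finite := by
    have : {t | ∃ a, r.assign t a ≠ none} ⊆ ⋃ τ, {t | ∃ a, r.assign t a = some τ} := by
      rintro t ⟨a, ha⟩
      obtain ⟨τ, hτ⟩ := Option.ne_none_iff_exists'.1 ha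
      exact Set.mem_iUnion.2 ⟨τ, a, hτ⟩
    refine (Set.finite_iUnion fun τ => Set.Subsingleton.finite ?_).subset this
    rintro t ⟨a, ha⟩ t' ⟨a', ha'⟩
    exact (r.assign_once t t' a a' τ ha ha').1
  obtain ⟨T, hT⟩ := hfin.bddAbove
  refine ⟨T + 1, fun t ht a => ?_⟩
  by_contra h
  have := hT (show t ∈ {t | ∃ a, r.assign t a ≠ none} from ⟨a, h⟩)
  omega

/-- Only free agents are given tasks, so an agent still at work after loading or unloading keeps its
task. -/
theorem Execution.assign_eq_none {t : ℕ} {a : A} {j : Job ι} (hj : r.job t a = j)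
    (h : arrive s g (r.pos (t + 1) a) j ≠ .free) : r.assign (t + 1) a = none := by
  by_contra hne
  exact h (by rw [← hj, ← r.held_succ, r.assign_free _ _ hne])

/-- A given task is completed before its agent becomes free. -/
theorem Execution.completedBy_of_free {t₁ T : ℕ} {a : A} {τ : ι} (h : r.assign t₁ a = some τ)
    (hT : t₁ ≤ T) (hfree : r.job T a = .free) : r.CompletedBy τ T := by
  classical
  have hjob : r.job t₁ a = arrive s g (r.pos t₁ a) (.toPickup τ) := by rw [r.job_eq, h]; rfl
  have hpick : ∀ t ≥ t₁, (∀ u, t₁ ≤ u → u ≤ t → r.pos u a ≠ s τ) → r.job t a = .toPickup τ := by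
    intro t ht
    induction t, ht using Nat.le_induction with
    | base =>
      intro hu
      simp [hjob, arrive, hu t₁ le_rfl le_rfl]
    | succ t ht ih =>
      intro hu
      have h1 := ih fun u hu1 hu2 => hu u hu1 (by omega)
      have h2 : arrive s g (r.pos (t + 1) a) (.toPickup τ) = .toPickup τ := by
        simp [arrive, hu (t + 1) (by omega) le_rfl]
      rw [r.job_succ (r.assign_eq_none h1 (by simp [h2])), h1, h2]
  -- Without a visit to the pickup node the agent would still be heading for it at `T`. The first
  -- visit serves as `t₂`; the first visit to the delivery node from then on serves as `t₃`.
  have hex : ∃ t, t₁ ≤ t ∧ t ≤ T ∧ r.pos t a = s τ := by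
    by_contra! hno
    have := hpick T hT hno
    simp [hfree] at this
  obtain ⟨h1, h2, h3⟩ := Nat.find_spec hex
  have hlt : ∀ u, t₁ ≤ u → u < Nat.find hex → r.pos u a ≠ s τ := fun u hu hu' e =>
    Nat.find_min hex hu' ⟨hu, by omega, e⟩
  have hbefore : ∀ t, t₁ ≤ t → t < Nat.find hex → r.job t a = .toPickup τ := fun t ht ht' =>
    hpick t ht fun u hu hu' => hlt u hu (by omega)
  generalize Nat.find hex = t₂ at h1 h2 h3 hlt hbefore
  have harr : arrive s g (r.pos t₂ a) (.toPickup τ) =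
      if r.pos t₂ a = g τ then .free else .toDelivery τ := by simp [arrive, h3]
  have hload : r.pos t₂ a ≠ g τ → r.job t₂ a = .toDelivery τ := by
    intro hg
    rw [if_neg hg] at harr
    -- In the first case the task was given at its pickup node and loaded at once.
    rcases h1.eq_or_lt with rfl | hlt'
    · rw [hjob, harr]
    · obtain ⟨t, rfl⟩ : ∃ t, t₂ = t + 1 := ⟨t₂ - 1, by omega⟩
      have hj := hbefore t (by omega) (by omega)
      rw [r.job_succ (r.assign_eq_none hj (by simp [harr])), hj, harr]
  have hdel : ∀ t ≥ t₂, (∀ u, t₂ ≤ u → u ≤ t → r.pos u a ≠ g τ) → r.job t a = .toDelivery τ := by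
    intro t ht
    induction t, ht using Nat.le_induction with
    | base => exact fun hu => hload (hu t₂ le_rfl le_rfl)
    | succ t ht ih =>
      intro hu
      have h1 := ih fun u hu1 hu2 => hu u hu1 (by omega)
      have h2 : arrive s g (r.pos (t + 1) a) (.toDelivery τ) = .toDelivery τ := by
        simp [arrive, hu (t + 1) (by omega) le_rfl]
      rw [r.job_succ (r.assign_eq_none h1 (by simp [h2])), h1, h2]
  have hex' : ∃ t, t₂ ≤ t ∧ t ≤ T ∧ r.pos t a = g τ := by
    by_contra! hno
    have := hdel T h2 hno
    simp [hfree] at this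
  obtain ⟨h4, h5, h6⟩ := Nat.find_spec hex'
  refine ⟨a, t₁, t₂, Nat.find hex', h1, h4, h5, h, hbefore, h3, fun t ht ht' => ?_, h6⟩
  exact hdel t ht fun u hu hu' e => Nat.find_min hex' (lt_of_le_of_lt hu' ht') ⟨hu, by omega, e⟩

end Execution

end PIBTTP

theorem theorem1 {V κ A ι : Type*} [Fintype V] [Finite κ] [Fintype A] [Nonempty A] [Finite ι]
    (E : PIBTTP.Environment V κ) (s g : ι → V)
    (hA1 : Fintype.card A < E.main.ncard)
    (hA2 : ∀ τ k, ¬ (s τ ∈ E.branch k ∧ g τ ∈ E.branch k))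
    (r : PIBTTP.Execution E s g A)
    (hA3 : ∀ t a τ k, r.assign t a = some τ → r.pos t a ∈ E.branch k → s τ ∉ E.branch k)
    (hassign : ∀ t, (∃ τ, ∀ t' ≤ t, ∀ a, r.assign t' a ≠ some τ) →
      (∀ a, r.job t a = PIBTTP.Job.free ∧ r.pos t a ∈ E.main) →
      ∃ t' > t, ∃ a, r.assign t' a ≠ none) :
    PIBTTP.CollisionFree E.graph r.pos ∧ ∃ T, ∀ τ, r.CompletedBy τ T := by
  have hreg := r.regular hA2 hA3
  refine ⟨r.collisionFree hreg, ?_⟩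
  obtain ⟨t₀, ht₀⟩ := r.exists_assign_eq_none
  obtain ⟨T, hT, hidle⟩ := r.exists_idle hA1 hreg ht₀
  refine ⟨T, fun τ => ?_⟩
  -- An ungiven task would force an assignment after `T`, hence after `t₀`.
  have hgiven : ∃ t ≤ T, ∃ a, r.assign t a = some τ := by
    by_contra! hno
    obtain ⟨t, ht, a, ha⟩ := hassign T ⟨τ, hno⟩ hidle
    exact ha (ht₀ t (by omega) a)
  obtain ⟨t, ht, a, ha⟩ := hgiven
  exact r.completedBy_of_free ha ht (hidle a).1
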